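/- **Setup.** Let $k$ be a field and $A$ an associative unital $k$-algebra. Suppose $A$ is a *regular triangular algebra*, that is, suppose the following are given. 1. Unital subalgebras $B_-,H,B_+$ of $A$ such that multiplication $B_-\otimes H\otimes B_+\to A$ is a linear isomorphism, with $B_-\otimes H$ and $H\otimes B_+$ (that is, their images) subalgebras; and an algebra map $\mathrm{ad}:H\to\mathrm{End}_k(A)$ that preserves $H$ and $B_\pm$. 2. A free action $*$ of a group $P$ on $G:=\mathrm{Hom}_{k\text{-alg}}(H,k)$ and a point $0_G\in G$, such that $\mathrm{ad}$ acts on $H$ by the weight $0_G$. For $\theta\in P$ write $A_\theta$ for the weight space $A_{\theta*0_G}$ of $(A,\mathrm{ad})$, and similarly for $B_\pm$. 3. A subalgebra $H_0\subset H$ and a free abelian group $P_0$ of finite rank that acts freely on $G_0:=\mathrm{Hom}_{k\text{-alg}}(H_0,k)$, such that the restriction map $\pi:G\to G_0$ sends $P*0_G$ onto $P_0*\pi(0_G)$ and intertwines the actions: if $\pi(\theta*0_G)=\theta_0*\pi(0_G)$ (we then write $\pi(\theta)=\theta_0$), then $\pi(\theta*\lambda)=\theta_0*\pi(\lambda)$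 for all $\lambda\in G$. 4. A basis $\Delta$ of $P_0$ such that $B_\pm=\bigoplus_{\theta\in P:\ \pi(\theta)\in\pm\mathbb Z_{\ge0}\Delta}(B_\pm)_\theta$. Writing $(B_\pm)_{\theta_0}$ for the sum of the weight spaces $(B_\pm)_\mu$ over all $\mu\in G$ with $\pi(\mu)=\theta_0*\pi(0_G)$, one has $(B_\pm)_0=k$ and $\dim (B_\pm)_{\theta_0}<\infty$ for all $\theta_0\in\pm\mathbb Z_{\ge0}\Delta$. 5. $A_\theta A_{\theta'}\subset A_{\theta\theta'}$ and $A_\theta M_\lambda\subset M_{\theta*\lambda}$ for all $\theta,\theta'\in P$, $\lambda\in G$ and all $A$-modules $M$. 6. An anti-involution $i$ of $A$ that fixes $H$ pointwise and maps $A_\theta$ to $A_{\theta^{-1}}$ for all $\theta\in P$. Let $N_\pm\subset B_\pm$ be the sum of the weight spaces $(B_\pm)_\theta$ with $\pi(\theta)\ne0$, so that $B_\pm=k\oplus N_\pm$. Let $\Gamma$ be a finite group acting on $A$ by $k$-algebra automorphisms; assume $\operatorname{char}k=0$ if $|\Gamma|>1$. Assume moreover: $\mathrm{ad}\,H$ and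 $\Gamma$ preserve $k,N_\pm,H_0,H$; $\mathrm{ad}$ and the $\Gamma$-action combine to an algebra map $H\rtimes\Gamma\to\mathrm{End}_k(A)$; $\Gamma$ commutes with $i$; for the action $\gamma(\lambda)(h):=\lambda(\gamma^{-1}(h))$ of $\Gamma$ on $G$, $\Gamma$ preserves $P*0_G$, and if $\gamma(\theta*0_G)=\theta'*0_G$ then $\gamma(\theta*\lambda)=\theta'*\gamma(\lambda)$ for all $\lambda\in G$; and $\Gamma$ preserves the partial order on $G_0$ given by $\mu\le\theta_0*\mu$ for $\mu\in G_0$, $\theta_0\in\mathbb Z_{\ge0}\Delta$. Let $A\rtimes\Gamma$ be the skew group ring ($\gamma a=\gamma(a)\gamma$) and $Z$ its center. For $\lambda\in G$ let $Z_A(\lambda)$ be the Verma module, i.e. the quotient of $A$ by the left ideal generated by $N_+$ and all $h-\lambda(h)$, $h\in H$, and let $V_A(\lambda)$ be its unique simple quotient. Let $S^3_A(\lambda)\subset G$ be the class of $\lambda$ under the equivalence relation generated by the pairs $(\nu,\mu)$ such that $V_A(\nu)$ is a subquotient of $Z_A(\mu)$. Put $\Gamma^\lambda:=\{\gamma\in\Gamma:\gamma(\lambda)=\lambda\}$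 and $\Gamma^{S^3_A(\lambda)}:=\bigcap_{\mu\in S^3_A(\lambda)}\Gamma^\mu$. Let $\xi:A=B_-\otimes H\otimes B_+\to H$ be the projection $\epsilon^-\otimes\mathrm{id}\otimes\epsilon^+$, where $\epsilon^\pm:B_\pm\to k$ has kernel $N_\pm$ and $\epsilon^\pm(1)=1$. The *central character* $\chi_\lambda:A\rtimes\Gamma\to k\Gamma$ is $$\chi_\lambda\Big(\sum_{\gamma\in\Gamma}a_\gamma\gamma\Big):=\sum_{\gamma\in\Gamma^\lambda}\lambda(\xi(a_\gamma))\,\gamma .$$ **Theorem.** 1. For every $\lambda\in G$, the restriction of $\chi_\lambda$ to $Z$ is a $k$-algebra map $Z\to k\Gamma$. 2. To each $\lambda\in G$ one can associate a subgroup $\Gamma_\lambda$ of $\Gamma^{S^3_A(\lambda)}$ such that - $\chi_\lambda(z)=\sum_{\gamma\in\Gamma_\lambda}\lambda(\xi(z_\gamma))\,\gamma$ for all $z=\sum_\gamma z_\gamma\gamma\in Z$; - $\Gamma_\lambda=\Gamma_\mu$ whenever $\mu\in S^3_A(\lambda)$; - for every $\mu\in S^3_A(\lambda)$ there is a character $\theta_{\lambda,\mu}:\Gamma_\lambda\to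 k^\times$ with $\lambda(\xi(z_\gamma))=\theta_{\lambda,\mu}(\gamma)\,\mu(\xi(z_\gamma))$ for all $\gamma\in\Gamma_\lambda$ and all $z=\sum_\gamma z_\gamma\gamma\in Z$. -/

import Mathlib

open scoped TensorProduct

/-- The data of a regular triangular algebra: subalgebras `B_-`, `B_+`, `H₀ ⊆ H` of `A`, an algebra
map `ad : H → End_k(A)`, an action `*` of a group `P` on the set `G` of characters of `H` together
with a distinguished character `0_G`, an action of the free abelian group `P₀` on the set `G₀` of
characters of `H₀`, a `ℤ`-basis `Δ` of `P₀` (the simple roots), and a linear map `i : A → A`. -/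
structure TriangularData (k A P P₀ ι : Type*) [Field k] [Ring A] [Algebra k A] [Group P]
    [AddCommGroup P₀] where
  Bm : Subalgebra k A
  Bp : Subalgebra k A
  H : Subalgebra k A
  H₀ : Subalgebra k A
  H₀_le : H₀ ≤ H
  ad : H →ₐ[k] Module.End k A
  star : P →* Equiv.Perm (H →ₐ[k] k)
  zeroG : H →ₐ[k] k
  star₀ : Multiplicative P₀ →* Equiv.Perm (H₀ →ₐ[k] k)
  Δ : Module.Basis ι ℤ P₀
  i : A →ₗ[k] A

namespace TriangularData

section Basic

variable {k A P P₀ ι : Type*} [Field k] [Ring A] [Algebra k A] [Group P] [AddCommGroup P₀]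
variable (D : TriangularData k A P P₀ ι)

/-- The set `G = Hom_{k-alg}(H, k)` of weights. -/
abbrev G : Type _ := D.H →ₐ[k] k

/-- The set `G₀ = Hom_{k-alg}(H₀, k)` of restricted weights. -/
abbrev G₀ : Type _ := D.H₀ →ₐ[k] k

/-- The restriction map `π : G → G₀`. -/
def res (μ : D.G) : D.G₀ := μ.comp (Subalgebra.inclusion D.H₀_le)

/-- The weight `θ * 0_G` attached to `θ ∈ P`. -/
def rootWt (θ : P) : D.G := D.star θ D.zeroG

/-- The restricted weight `θ₀ * π(0_G)` attached to `θ₀ ∈ P₀`. -/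
def rootWt₀ (θ₀ : P₀) : D.G₀ := D.star₀ (Multiplicative.ofAdd θ₀) (D.res D.zeroG)

/-- The cone `ℤ_{≥0} Δ` in `P₀`. -/
def posCone : Set P₀ := AddSubmonoid.closure (Set.range D.Δ)

/-- The cone `-ℤ_{≥0} Δ` in `P₀`. -/
def negCone : Set P₀ := {θ₀ | -θ₀ ∈ D.posCone}

/-- The weight space `A_μ` of `A` under the action `ad` of `H`. -/
def adWt (μ : D.G) : Submodule k A where
  carrier := {a | ∀ h : D.H, D.ad h a = μ h • a}
  zero_mem' := fun h => by simp
  add_mem' := fun {a b} ha hb h => by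
    rw [map_add, ha h, hb h, smul_add]
  smul_mem' := fun c a ha h => by
    rw [map_smul, ha h, smul_comm]

/-- The weight space `M_μ` of a left `A`-module `M`, under the action of `H ⊆ A`. -/
def modWt (M : Type*) [AddCommGroup M] [Module A M] (μ : D.G) : Set M :=
  {m | ∀ h : D.H, (h : A) • m = algebraMap k A (μ h) • m}

/-- The weight space `B_μ` of a subalgebra `B` of `A`, under `ad`. -/
def comp (B : Subalgebra k A) (μ : D.G) : Submodule k A := D.adWt μ ⊓ B.toSubmodule

/-- For `θ₀ ∈ P₀`, the sum `B_{θ₀}` of all weight spaces `B_μ` with `π(μ) = θ₀ * π(0_G)`. -/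
def resComp (B : Subalgebra k A) (θ₀ : P₀) : Submodule k A :=
  ⨆ μ : {μ : D.G // D.res μ = D.rootWt₀ θ₀}, D.comp B μ

/-- The elements `θ` of `P` whose restriction `π(θ)` lies in the cone `C ⊆ P₀`. -/
def overCone (C : Set P₀) : Set P := {θ | ∃ θ₀ ∈ C, D.res (D.rootWt θ) = D.rootWt₀ θ₀}

/-- `B` is the direct sum of its weight spaces `B_θ` with `θ ∈ P` and `π(θ) ∈ C`; the summand of
restricted weight `0` is `k`, and all summands `B_{θ₀}` for `θ₀ ∈ C` are finite-dimensional. -/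
structure IsRegularlyGraded (B : Subalgebra k A) (C : Set P₀) : Prop where
  indep : iSupIndep fun θ : D.overCone C => D.comp B (D.rootWt θ)
  sup : ⨆ θ : D.overCone C, D.comp B (D.rootWt θ) = B.toSubmodule
  zero : D.resComp B 0 = 1
  fin : ∀ θ₀ ∈ C, FiniteDimensional k (D.resComp B θ₀)

/-- The augmentation ideal of `B`, i.e. the sum of the weight spaces of nonzero restricted
weight. -/
def aug (B : Subalgebra k A) (C : Set P₀) : Submodule k A :=
  ⨆ θ : {θ : D.overCone C // D.res (D.rootWt θ) ≠ D.rootWt₀ 0}, D.comp B (D.rootWt θ)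

/-- The augmentation ideal `N_+` of `B_+`. -/
def Np : Submodule k A := D.aug D.Bp D.posCone

/-- The augmentation ideal `N_-` of `B_-`. -/
def Nm : Submodule k A := D.aug D.Bm D.negCone

/-- The multiplication map `B_- ⊗ H ⊗ B_+ → A`. -/
noncomputable def mulMap : ((D.Bm ⊗[k] D.H) ⊗[k] D.Bp) →ₗ[k] A :=
  LinearMap.mul' k A ∘ₗ
    TensorProduct.map
      (LinearMap.mul' k A ∘ₗ TensorProduct.map D.Bm.val.toLinearMap D.H.val.toLinearMap)
      D.Bp.val.toLinearMap

/-- The partial order on `G₀`: `μ ≤ μ'` iff `μ' = θ₀ * μ` for some `θ₀ ∈ ℤ_{≥0} Δ`. -/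
def le₀ (μ μ' : D.G₀) : Prop := ∃ θ₀ ∈ D.posCone, D.star₀ (Multiplicative.ofAdd θ₀) μ = μ'

end Basic

section RTA

universe v

variable {k : Type*} {A : Type v} {P P₀ ι : Type*} [Field k] [Ring A] [Algebra k A] [Group P]
  [AddCommGroup P₀]

/-- The axioms of a regular triangular algebra. -/
structure IsRTA (D : TriangularData k A P P₀ ι) : Prop where
  /-- The triangular decomposition. -/
  triangular : Function.Bijective D.mulMap
  /-- `ad` preserves `H` and `B_±`. -/
  ad_H : ∀ h : D.H, ∀ a ∈ D.H, D.ad h a ∈ D.H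
  ad_Bm : ∀ h : D.H, ∀ a ∈ D.Bm, D.ad h a ∈ D.Bm
  ad_Bp : ∀ h : D.H, ∀ a ∈ D.Bp, D.ad h a ∈ D.Bp
  /-- The images in `A` of `B_- ⊗ H` and `H ⊗ B_+` are subalgebras. -/
  Bm_H : ∃ S : Subalgebra k A, S.toSubmodule = D.Bm.toSubmodule * D.H.toSubmodule
  H_Bp : ∃ S : Subalgebra k A, S.toSubmodule = D.H.toSubmodule * D.Bp.toSubmodule
  /-- The action of `P` on `G` is free. -/
  star_free : ∀ (θ : P) (μ : D.G), D.star θ μ = μ → θ = 1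
  /-- `H` equals its weight space of weight `0_G` for `ad`. -/
  H_wt : ∀ a ∈ D.H, a ∈ D.adWt D.zeroG
  /-- The action of `P₀` on `G₀` is free. -/
  star₀_free : ∀ (θ₀ : P₀) (μ : D.G₀), D.star₀ (Multiplicative.ofAdd θ₀) μ = μ → θ₀ = 0
  /-- `π` maps `P * 0_G` onto `P₀ * π(0_G)`. -/
  res_onto : D.res '' Set.range D.rootWt = Set.range D.rootWt₀
  /-- `π` intertwines the actions: if `π(θ) = θ₀` then `π(θ * μ) = θ₀ * π(μ)`. -/
  res_star : ∀ (θ : P) (θ₀ : P₀), D.res (D.rootWt θ) = D.rootWt₀ θ₀ →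
    ∀ μ : D.G, D.res (D.star θ μ) = D.star₀ (Multiplicative.ofAdd θ₀) (D.res μ)
  /-- The weight decompositions of `B_±`, and their regularity. -/
  graded_Bm : D.IsRegularlyGraded D.Bm D.negCone
  graded_Bp : D.IsRegularlyGraded D.Bp D.posCone
  /-- The property of weights. -/
  wt_mul : ∀ (θ θ' : P) (a b : A), a ∈ D.adWt (D.rootWt θ) → b ∈ D.adWt (D.rootWt θ') →
    a * b ∈ D.adWt (D.rootWt (θ * θ'))
  wt_smul : ∀ (M : Type v) [AddCommGroup M] [Module A M] (θ : P) (μ : D.G) (a : A) (m : M),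
    a ∈ D.adWt (D.rootWt θ) → m ∈ D.modWt M μ → a • m ∈ D.modWt M (D.star θ μ)
  /-- `i` is an anti-involution of `A` that fixes `H` and takes `A_θ` to `A_{θ⁻¹}`. -/
  i_mul : ∀ a b : A, D.i (a * b) = D.i b * D.i a
  i_i : ∀ a : A, D.i (D.i a) = a
  i_H : ∀ a ∈ D.H, D.i a = a
  i_wt : ∀ (θ : P) (a : A), a ∈ D.adWt (D.rootWt θ) → D.i a ∈ D.adWt (D.rootWt θ⁻¹)

end RTA

section HarishChandra

variable {k A P P₀ ι : Type*} [Field k] [Ring A] [Algebra k A] [Group P] [AddCommGroup P₀]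
variable {D : TriangularData k A P P₀ ι}

theorem rootWt_one : D.rootWt 1 = D.zeroG := by simp [rootWt]

theorem rootWt₀_zero : D.rootWt₀ 0 = D.res D.zeroG := by simp [rootWt₀]

/-- `B = k ⊕ N` for the augmentation ideal `N` of `B`. -/
theorem IsRegularlyGraded.isCompl_aug [Nontrivial A] {B : Subalgebra k A} {C : Set P₀}
    (hC : (0 : P₀) ∈ C) (hz : ∀ a ∈ D.H, a ∈ D.adWt D.zeroG) (hB : D.IsRegularlyGraded B C) :
    ∃ ε : B →ₗ[k] k, ε 1 = 1 ∧ ∀ b : B, ε b = 0 ↔ (b : A) ∈ D.aug B C := by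
  have h1 : (1 : P) ∈ D.overCone C := ⟨0, hC, by rw [rootWt_one, rootWt₀_zero]⟩
  have hone : (1 : A) ∈ D.comp B (D.rootWt 1) := by
    refine ⟨?_, B.one_mem⟩
    rw [rootWt_one]
    exact hz 1 D.H.one_mem
  have hdis : Disjoint (D.comp B (D.rootWt 1)) (D.aug B C) := by
    refine (hB.indep ⟨1, h1⟩).mono_right ?_
    refine iSup_le fun θ => ?_
    refine le_iSup₂_of_le θ.1 ?_ le_rfl
    intro h
    apply θ.2
    rw [h, rootWt_one, rootWt₀_zero]
  have hnot : (1 : A) ∉ D.aug B C := fun h =>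
    one_ne_zero (Submodule.disjoint_def.1 hdis 1 hone h)
  have hsup : ∀ b ∈ B, ∃ c : k, b - algebraMap k A c ∈ D.aug B C := by
    intro b hb
    have hb' : b ∈ (1 : Submodule k A) ⊔ D.aug B C := by
      have : B.toSubmodule ≤ (1 : Submodule k A) ⊔ D.aug B C := by
        rw [← hB.sup]
        refine iSup_le fun θ => ?_
        by_cases hθ : D.res (D.rootWt θ) = D.rootWt₀ 0
        · refine le_trans ?_ le_sup_left
          rw [← hB.zero]
          exact le_iSup_of_le (f := fun μ : {μ : D.G // D.res μ = D.rootWt₀ 0} => D.comp B μ)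
            ⟨_, hθ⟩ le_rfl
        · refine le_trans ?_ le_sup_right
          exact le_iSup_of_le
            (f := fun θ : {θ : D.overCone C // D.res (D.rootWt θ) ≠ D.rootWt₀ 0} =>
              D.comp B (D.rootWt θ)) ⟨θ, hθ⟩ le_rfl
      exact this hb
    obtain ⟨y, hy, z, hz', rfl⟩ := Submodule.mem_sup.1 hb'
    obtain ⟨c, rfl⟩ := Submodule.mem_one.1 hy
    exact ⟨c, by simpa using hz'⟩
  have huniq : ∀ c : k, algebraMap k A c ∈ D.aug B C → c = 0 := by
    intro c hc
    by_contra h0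
    apply hnot
    have := (D.aug B C).smul_mem c⁻¹ hc
    rwa [Algebra.algebraMap_eq_smul_one, smul_smul, inv_mul_cancel₀ h0, one_smul] at this
  choose f hf using fun b : B => hsup b b.2
  have hval : ∀ (b : B) (c : k), (b : A) - algebraMap k A c ∈ D.aug B C → f b = c := by
    intro b c hc
    have := (D.aug B C).sub_mem hc (hf b)
    rw [sub_sub_sub_cancel_left, ← map_sub] at this
    exact sub_eq_zero.1 (huniq _ this)
  refine ⟨{ toFun := f, map_add' := ?_, map_smul' := ?_ }, ?_, ?_⟩
  · intro x y
    refine hval _ _ ?_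
    have := (D.aug B C).add_mem (hf x) (hf y)
    rwa [sub_add_sub_comm, ← map_add] at this
  · intro c x
    refine hval _ _ ?_
    have := (D.aug B C).smul_mem c (hf x)
    rw [smul_sub, Algebra.algebraMap_eq_smul_one, smul_smul,
      ← Algebra.algebraMap_eq_smul_one] at this
    exact this
  · exact hval _ _ (by simp)
  · intro b
    constructor
    · intro h
      have := hf b
      rw [show f b = 0 from h] at this
      simpa using this
    · intro h
      exact hval _ _ (by simpa using h)

/-- In an algebra with weights, `1 ≠ 0`. -/
theorem nontrivial (D : TriangularData k A P P₀ ι) : Nontrivial A := by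
  by_contra h
  rw [not_nontrivial_iff_subsingleton] at h
  have h10 : (1 : D.H) = 0 := Subtype.ext (Subsingleton.elim _ _)
  have : D.zeroG 1 = D.zeroG 0 := by rw [h10]
  simp at this

theorem exists_εm (hD : D.IsRTA) :
    ∃ ε : D.Bm →ₗ[k] k, ε 1 = 1 ∧ ∀ b : D.Bm, ε b = 0 ↔ (b : A) ∈ D.Nm :=
  haveI := D.nontrivial
  hD.graded_Bm.isCompl_aug (by simp [negCone, posCone]) hD.H_wt

theorem exists_εp (hD : D.IsRTA) :
    ∃ ε : D.Bp →ₗ[k] k, ε 1 = 1 ∧ ∀ b : D.Bp, ε b = 0 ↔ (b : A) ∈ D.Np :=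
  haveI := D.nontrivial
  hD.graded_Bp.isCompl_aug (by simp [posCone]) hD.H_wt

/-- The augmentation `ε^- : B_- → k`, the linear map with `ε^-(1) = 1` and kernel `N_-`. -/
noncomputable def εm (hD : D.IsRTA) : D.Bm →ₗ[k] k := (exists_εm hD).choose

/-- The augmentation `ε^+ : B_+ → k`, the linear map with `ε^+(1) = 1` and kernel `N_+`. -/
noncomputable def εp (hD : D.IsRTA) : D.Bp →ₗ[k] k := (exists_εp hD).choose

/-- The Harish-Chandra projection `ξ = ε^- ⊗ id ⊗ ε^+ : A = B_- ⊗ H ⊗ B_+ → H`. -/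
noncomputable def ξ (hD : D.IsRTA) : A →ₗ[k] D.H :=
  (TensorProduct.rid k D.H).toLinearMap ∘ₗ
    TensorProduct.map
      ((TensorProduct.lid k D.H).toLinearMap ∘ₗ TensorProduct.map (εm hD) LinearMap.id)
      (εp hD) ∘ₗ
    (LinearEquiv.ofBijective D.mulMap hD.triangular).symm.toLinearMap

end HarishChandra

section Verma

variable {k A P P₀ ι : Type*} [Field k] [Ring A] [Algebra k A] [Group P] [AddCommGroup P₀]
variable (D : TriangularData k A P P₀ ι)

/-- The left ideal of `A` generated by `N_+` and by all `h - μ(h)`, `h ∈ H`. -/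
def vermaIdeal (μ : D.G) : Submodule A A :=
  Submodule.span A ((D.Np : Set A) ∪ Set.range fun h : D.H => (h : A) - algebraMap k A (μ h))

/-- The Verma module `Z_A(μ)`. -/
abbrev Verma (μ : D.G) : Type _ := A ⧸ D.vermaIdeal μ

/-- The simple module `V_A(μ)`: the quotient of `Z_A(μ)` by the sum of its proper submodules. -/
abbrev Simple (μ : D.G) : Type _ :=
  D.Verma μ ⧸ sSup {N : Submodule A (D.Verma μ) | N ≠ ⊤}

/-- `[Z_A(μ) : V_A(ν)] > 0`: the simple module `V_A(ν)` is a subquotient of `Z_A(μ)`. -/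
def IsFactor (ν μ : D.G) : Prop :=
  ∃ (N : Submodule A (D.Verma μ)) (N' : Submodule A N), Nonempty ((N ⧸ N') ≃ₗ[A] D.Simple ν)

/-- The set `S³_A(μ)`: the equivalence class of `μ` for the equivalence relation on `G` generated
by the relation "`V_A(ν)` is a subquotient of `Z_A(ν')`". -/
def S3 (μ : D.G) : Set D.G := {ν | Relation.EqvGen D.IsFactor μ ν}

end Verma

section Skew

variable {k A P P₀ ι : Type*} [Field k] [Ring A] [Algebra k A] [Group P] [AddCommGroup P₀]
variable {Γ : Type*} [Group Γ] [MulSemiringAction Γ A] [SMulCommClass Γ k A]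

/-- The action of `γ ∈ Γ` on the characters of a `Γ`-stable subalgebra `S` of `A`, given by
`(γ(μ))(s) = μ(γ⁻¹(s))`. -/
def charAct {S : Subalgebra k A} (hS : ∀ γ : Γ, ∀ s ∈ S, γ • s ∈ S) (γ : Γ) (μ : S →ₐ[k] k) :
    S →ₐ[k] k :=
  μ.comp (((MulSemiringAction.toAlgHom k A γ⁻¹).comp S.val).codRestrict S fun s => hS γ⁻¹ s s.2)

theorem charAct_apply {S : Subalgebra k A} (hS : ∀ γ : Γ, ∀ s ∈ S, γ • s ∈ S) (γ : Γ)
    (μ : S →ₐ[k] k) (s : S) : charAct hS γ μ s = μ ⟨γ⁻¹ • (s : A), hS γ⁻¹ s s.2⟩ := rfl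

theorem charAct_one {S : Subalgebra k A} (hS : ∀ γ : Γ, ∀ s ∈ S, γ • s ∈ S) (μ : S →ₐ[k] k) :
    charAct hS 1 μ = μ := by
  ext s
  simp [charAct_apply]

theorem charAct_mul {S : Subalgebra k A} (hS : ∀ γ : Γ, ∀ s ∈ S, γ • s ∈ S) (γ γ' : Γ)
    (μ : S →ₐ[k] k) : charAct hS (γ * γ') μ = charAct hS γ (charAct hS γ' μ) := by
  ext s
  simp [charAct_apply, mul_smul]

/-- The compatibility of an action of `Γ` on `A` by `k`-algebra automorphisms with the structure of
a regular triangular algebra on `A`. -/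
structure IsCompatible (D : TriangularData k A P P₀ ι) (Γ : Type*) [Group Γ]
    [MulSemiringAction Γ A] [SMulCommClass Γ k A] : Prop where
  /-- `k`, `N_±`, `H₀` and `H` are preserved by the actions of `H` (via `ad`) and of `Γ`. -/
  ad_k : ∀ (h : D.H) (c : k), D.ad h (algebraMap k A c) ∈ (⊥ : Subalgebra k A)
  ad_Nm : ∀ h : D.H, ∀ a ∈ D.Nm, D.ad h a ∈ D.Nm
  ad_Np : ∀ h : D.H, ∀ a ∈ D.Np, D.ad h a ∈ D.Np
  ad_H₀ : ∀ h : D.H, ∀ a ∈ D.H₀, D.ad h a ∈ D.H₀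
  ad_H : ∀ h : D.H, ∀ a ∈ D.H, D.ad h a ∈ D.H
  smul_Nm : ∀ γ : Γ, ∀ a ∈ D.Nm, γ • a ∈ D.Nm
  smul_Np : ∀ γ : Γ, ∀ a ∈ D.Np, γ • a ∈ D.Np
  smul_H₀ : ∀ γ : Γ, ∀ a ∈ D.H₀, γ • a ∈ D.H₀
  smul_H : ∀ γ : Γ, ∀ a ∈ D.H, γ • a ∈ D.H
  /-- `ad : H → End_k(A)` and `Γ → Aut(A)` combine to an algebra map `H ⋊ Γ → End_k(A)`. -/
  smul_ad : ∀ (γ : Γ) (h : D.H) (a : A),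
    γ • D.ad h a = D.ad ⟨γ • (h : A), smul_H γ h h.2⟩ (γ • a)
  /-- `Γ` commutes with the anti-involution. -/
  smul_i : ∀ (γ : Γ) (a : A), D.i (γ • a) = γ • D.i a
  /-- `Γ` maps `P * 0_G` into itself; writing `γ(θ * 0_G) = γ(θ) * 0_G`, one has
  `γ(θ * μ) = γ(θ) * γ(μ)`. -/
  smul_star : ∀ (γ : Γ) (θ : P), ∃ θ' : P, charAct smul_H γ (D.rootWt θ) = D.rootWt θ' ∧
    ∀ μ : D.G, charAct smul_H γ (D.star θ μ) = D.star θ' (charAct smul_H γ μ)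
  /-- `Γ` acts on `G₀` by order-preserving maps. -/
  smul_le₀ : ∀ (γ : Γ) (μ μ' : D.G₀), D.le₀ μ μ' →
    D.le₀ (charAct smul_H₀ γ μ) (charAct smul_H₀ γ μ')

variable {D : TriangularData k A P P₀ ι}

/-- The stabilizer `Γ^μ` of a weight `μ`. -/
def stab (hΓ : D.IsCompatible Γ) (μ : D.G) : Subgroup Γ where
  carrier := {γ | charAct hΓ.smul_H γ μ = μ}
  one_mem' := charAct_one _ _
  mul_mem' := fun {a b} ha hb => by
    simp only [Set.mem_ofPred_eq] at ha hb ⊢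
    rw [charAct_mul, hb, ha]
  inv_mem' := fun {a} ha => by
    simp only [Set.mem_ofPred_eq] at ha ⊢
    conv_lhs => rw [← ha]
    rw [← charAct_mul, inv_mul_cancel, charAct_one]

/-- The subgroup `Γ^{S³_A(μ)}` fixing every weight in `S³_A(μ)`. -/
def stabS3 (hΓ : D.IsCompatible Γ) (μ : D.G) : Subgroup Γ := ⨅ ν ∈ D.S3 μ, stab hΓ ν

/-- For `r = ∑ a_γ γ ∈ A ⋊ Γ` and a subgroup `Γ'`, the sum `∑_{γ ∈ Γ'} μ(ξ(a_γ)) γ ∈ kΓ`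
(used for finite `Γ`). -/
noncomputable def partialChar (hD : D.IsRTA) (μ : D.G) (Γ' : Subgroup Γ)
    (r : SkewMonoidAlgebra A Γ) : MonoidAlgebra k Γ :=
  ∑ᶠ γ : Γ', MonoidAlgebra.single (γ : Γ) (μ (ξ hD (r.coeff γ)))

/-- The central character `χ_μ : A ⋊ Γ → kΓ`, `∑ a_γ γ ↦ ∑_{γ ∈ Γ^μ} μ(ξ(a_γ)) γ`. -/
noncomputable def centralChar (hD : D.IsRTA) (hΓ : D.IsCompatible Γ) (μ : D.G)
    (r : SkewMonoidAlgebra A Γ) : MonoidAlgebra k Γ :=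
  partialChar hD μ (stab hΓ μ) r

end Skew

end TriangularData

/-! Comparing coefficients in `a * z = z * a`, for `z` central and `a ∈ A`, gives `a z_γ = z_γ
γ(a)`. Applied to the highest weight vector `v_μ` of `Z_A(μ)`, this says that `z_γ v_μ` has weight
`γ⁻¹(μ)`. The weights of `Z_A(μ)` are `μ` and weights strictly below it after restriction to `H₀`.
An order-preserving map of finite order cannot move a weight strictly down, so either `z_γ v_μ = 0`
or `γ` fixes `μ`; in both cases `z_γ v_μ = μ(ξ(z_γ)) v_μ` (`toVerma_coeff`). Multiplicativity of
`χ_μ` on the center follows, because `z_γ γ(z'_δ) = z'_δ z_γ`.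

Let `Γ_μ` be generated by all `γ` with `μ(ξ(z_γ)) ≠ 0` for some central `z`. If `V_A(ν)` is a
subquotient of `Z_A(μ)`, lift its highest weight vector to `a ∈ A`, taken modulo a left ideal `K`
containing the one that defines `Z_A(μ)`. Computing `z_γ a` in two ways gives `μ(ξ(z_γ)) γ⁻¹(a) ≡
ν(ξ(z_γ)) a` mod `K`. Hence `Γ_μ` acts on the line of `a` mod `K` by a character, which is the ratio
of the two central characters (`isProportional_of_isFactor`). Proportionality is an equivalence
relation, so it spreads over `S³_A(μ)`. -/

namespace TriangularData

/-! ### Independence of simultaneous eigenspaces. -/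

section WeightSpaces

variable {k R M : Type*} [Field k] [Ring R] [Algebra k R] [AddCommGroup M] [Module k M]

/-- The simultaneous eigenspace of weight `μ` in a representation `ρ` of the algebra `R`. -/
def weightSpace (ρ : R →ₐ[k] Module.End k M) (μ : R →ₐ[k] k) : Submodule k M where
  carrier := {m | ∀ r, ρ r m = μ r • m}
  zero_mem' := fun r => by simp
  add_mem' := fun {a b} ha hb r => by rw [map_add, ha r, hb r, smul_add]
  smul_mem' := fun c a ha r => by rw [map_smul, ha r, smul_comm]

theorem mem_weightSpace {ρ : R →ₐ[k] Module.End k M} {μ : R →ₐ[k] k} {m : M} :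
    m ∈ weightSpace ρ μ ↔ ∀ r, ρ r m = μ r • m := Iff.rfl

theorem exists_separating {μ ν : R →ₐ[k] k} (h : μ ≠ ν) : ∃ r, μ r = 1 ∧ ν r = 0 := by
  obtain ⟨r, hr⟩ : ∃ r, μ r ≠ ν r := by
    by_contra! hc
    exact h (AlgHom.ext hc)
  have hr' : μ r - ν r ≠ 0 := sub_ne_zero.2 hr
  refine ⟨(μ r - ν r)⁻¹ • (r - algebraMap k R (ν r)), ?_, ?_⟩
  · simp [inv_mul_cancel₀ hr']
  · simp

/-- A sum of weight vectors of weights different from `μ` is killed by some element of `R` on which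
`μ` takes the value `1`. -/
theorem exists_annihilator {κ : Type*} {ρ : R →ₐ[k] Module.End k M} {μ : R →ₐ[k] k}
    {w : κ → (R →ₐ[k] k)} (hw : ∀ j, μ ≠ w j) {m : M} (hm : m ∈ ⨆ j, weightSpace ρ (w j)) :
    ∃ r, μ r = 1 ∧ ρ r m = 0 := by
  -- `R` need not be commutative: to combine annihilators `r` and `r'` into `r * r'`, the element
  -- `r` must kill the whole orbit of its vector, including `ρ r'` of it.
  suffices ∃ r, μ r = 1 ∧ ∀ s, ρ r (ρ s m) = 0 by
    obtain ⟨r, hr, h⟩ := this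
    exact ⟨r, hr, by simpa using h 1⟩
  induction hm using Submodule.iSup_induction' with
  | mem j x hx =>
    obtain ⟨r, hr, hr'⟩ := exists_separating (hw j)
    refine ⟨r, hr, fun s => ?_⟩
    rw [hx s, map_smul, hx r, hr', zero_smul, smul_zero]
  | zero => exact ⟨1, map_one _, fun s => by simp⟩
  | add x y _ _ hx hy =>
    obtain ⟨r, hr, h⟩ := hx
    obtain ⟨r', hr', h'⟩ := hy
    refine ⟨r * r', by rw [map_mul, hr, hr', one_mul], fun s => ?_⟩
    have h1 : ρ (r * r') (ρ s x) = 0 := by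
      have := h (r' * s)
      simpa only [map_mul, Module.End.mul_apply] using this
    have h2 : ρ (r * r') (ρ s y) = 0 := by
      rw [map_mul, Module.End.mul_apply, h', map_zero]
    rw [map_add, map_add, h1, h2, add_zero]

theorem eq_zero_of_mem_weightSpace_of_mem_iSup {κ : Type*} {ρ : R →ₐ[k] Module.End k M}
    {μ : R →ₐ[k] k} {w : κ → (R →ₐ[k] k)} (hw : ∀ j, μ ≠ w j) {m : M}
    (hμ : m ∈ weightSpace ρ μ) (hm : m ∈ ⨆ j, weightSpace ρ (w j)) : m = 0 := by
  obtain ⟨r, hr, h⟩ := exists_annihilator hw hm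
  rw [hμ r, hr, one_smul] at h
  exact h

end WeightSpaces

/-! ### The positive cone, the order on `G₀`, and products with `N_+`. -/

section Structure

variable {k A P P₀ ι : Type*} [Field k] [Ring A] [Algebra k A] [Group P] [AddCommGroup P₀]
variable {D : TriangularData k A P P₀ ι}

theorem adWt_eq_weightSpace (μ : D.G) : D.adWt μ = weightSpace D.ad μ := rfl

theorem zero_mem_posCone : (0 : P₀) ∈ D.posCone := AddSubmonoid.zero_mem _

theorem add_mem_posCone {a b : P₀} (ha : a ∈ D.posCone) (hb : b ∈ D.posCone) :
    a + b ∈ D.posCone := AddSubmonoid.add_mem _ ha hb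

theorem repr_nonneg_of_mem_posCone {a : P₀} (ha : a ∈ D.posCone) (j : ι) : 0 ≤ D.Δ.repr a j := by
  refine AddSubmonoid.closure_induction (motive := fun a _ => 0 ≤ D.Δ.repr a j) ?_ ?_ ?_ ha
  · rintro _ ⟨l, rfl⟩
    rw [Module.Basis.repr_self]
    classical
    rw [Finsupp.single_apply]
    split_ifs <;> simp
  · simp
  · intro x y _ _ hx hy
    rw [map_add, Finsupp.add_apply]
    exact add_nonneg hx hy

/-- The cone is pointed, since its elements have nonnegative coordinates in the basis `Δ`. -/
theorem eq_zero_of_add_eq_zero {a b : P₀} (ha : a ∈ D.posCone) (hb : b ∈ D.posCone)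
    (h : a + b = 0) : a = 0 := by
  refine D.Δ.ext_elem fun j => ?_
  have h1 := repr_nonneg_of_mem_posCone ha j
  have h2 := repr_nonneg_of_mem_posCone hb j
  have h3 : D.Δ.repr a j + D.Δ.repr b j = 0 := by
    rw [← Finsupp.add_apply, ← map_add, h]
    simp
  rw [map_zero, Finsupp.zero_apply]
  linarith

theorem le₀_refl (x : D.G₀) : D.le₀ x x := ⟨0, zero_mem_posCone, by simp⟩

theorem le₀_trans {x y z : D.G₀} (h : D.le₀ x y) (h' : D.le₀ y z) : D.le₀ x z := by
  obtain ⟨a, ha, rfl⟩ := h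
  obtain ⟨b, hb, rfl⟩ := h'
  exact ⟨b + a, add_mem_posCone hb ha, by rw [ofAdd_add, map_mul, Equiv.Perm.mul_apply]⟩

theorem le₀_antisymm (hD : D.IsRTA) {x y : D.G₀} (h : D.le₀ x y) (h' : D.le₀ y x) : x = y := by
  obtain ⟨a, ha, rfl⟩ := h
  obtain ⟨b, hb, h⟩ := h'
  have h0 : b + a = 0 := by
    refine hD.star₀_free _ x ?_
    rwa [ofAdd_add, map_mul, Equiv.Perm.mul_apply]
  rw [eq_zero_of_add_eq_zero ha hb (by rwa [add_comm])]
  simp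

theorem rootWt₀_injective (hD : D.IsRTA) : Function.Injective D.rootWt₀ := by
  intro a b h
  have : D.star₀ (Multiplicative.ofAdd (-b + a)) (D.res D.zeroG) = D.res D.zeroG := by
    rw [ofAdd_add, map_mul, Equiv.Perm.mul_apply]
    change D.star₀ _ (D.rootWt₀ a) = _
    rw [h, rootWt₀, ← Equiv.Perm.mul_apply, ← map_mul, ← ofAdd_add]
    simp
  exact (neg_add_eq_zero.1 (hD.star₀_free _ _ this)).symm

theorem rootWt_one_mem_comp (hD : D.IsRTA) {h : A} (hh : h ∈ D.H) : h ∈ D.adWt (D.rootWt 1) := by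
  rw [rootWt_one]
  exact hD.H_wt h hh

theorem aug_le (B : Subalgebra k A) (C : Set P₀) : D.aug B C ≤ B.toSubmodule :=
  iSup_le fun _ => inf_le_right

theorem comp_le_aug (B : Subalgebra k A) {C : Set P₀} {θ : P} (hθ : θ ∈ D.overCone C)
    (h : D.res (D.rootWt θ) ≠ D.rootWt₀ 0) : D.comp B (D.rootWt θ) ≤ D.aug B C :=
  le_iSup_of_le
    (f := fun θ : {θ : D.overCone C // D.res (D.rootWt θ) ≠ D.rootWt₀ 0} =>
      D.comp B (D.rootWt θ)) ⟨⟨θ, hθ⟩, h⟩ le_rfl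

theorem res_rootWt_mul (hD : D.IsRTA) {θ θ' : P} {a b : P₀}
    (h : D.res (D.rootWt θ) = D.rootWt₀ a) (h' : D.res (D.rootWt θ') = D.rootWt₀ b) :
    D.res (D.rootWt (θ * θ')) = D.rootWt₀ (a + b) := by
  have : D.rootWt (θ * θ') = D.star θ (D.rootWt θ') := by
    rw [rootWt, rootWt, map_mul, Equiv.Perm.mul_apply]
  rw [this, hD.res_star θ a h, h', rootWt₀, rootWt₀, ofAdd_add, map_mul, Equiv.Perm.mul_apply]

/-- Restricted weights add under multiplication, and in a pointed cone adding to a nonzero element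
never gives zero. -/
theorem mul_mem_Np (hD : D.IsRTA) {b n : A} (hb : b ∈ D.Bp) (hn : n ∈ D.Np) : b * n ∈ D.Np := by
  have hb' : b ∈ ⨆ θ : D.overCone D.posCone, D.comp D.Bp (D.rootWt θ) := by
    rw [hD.graded_Bp.sup]
    exact hb
  induction hb' using Submodule.iSup_induction' with
  | zero => simp
  | add x y hx hy ihx ihy =>
    rw [hD.graded_Bp.sup] at hx hy
    rw [add_mul]
    exact add_mem (ihx hx) (ihy hy)
  | mem θ x hx =>
    obtain ⟨θ, a, ha, hθ⟩ := θ
    have hn' := hn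
    rw [Np, aug] at hn'
    clear hb
    induction hn' using Submodule.iSup_induction' with
    | zero => simp
    | add y z hy hz ihy ihz =>
      rw [mul_add]
      exact add_mem (ihy hy) (ihz hz)
    | mem θ' y hy =>
      obtain ⟨⟨θ', b, hb, hθ'⟩, h0⟩ := θ'
      have hmul := res_rootWt_mul hD hθ hθ'
      refine comp_le_aug D.Bp (θ := θ * θ') ⟨a + b, add_mem_posCone ha hb, hmul⟩ ?_
        ⟨hD.wt_mul θ θ' x y hx.1 hy.1, D.Bp.mul_mem hx.2 hy.2⟩
      intro h
      rw [hmul] at h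
      have := eq_zero_of_add_eq_zero hb ha (by rw [add_comm]; exact rootWt₀_injective hD h)
      rw [this] at hθ'
      exact h0 hθ'

/-- Since `H` has weight `0_G`, the product `n * h` keeps the weight of `n`. It also lies in `H
B_+`, and independence of weight spaces leaves only its component in `H (B_+)_θ`. This allows
elements of `H` to be moved to the left of `N_+`. -/
theorem mul_mem_H_mul_Np (hD : D.IsRTA) {n h : A} (hn : n ∈ D.Np) (hh : h ∈ D.H) :
    n * h ∈ D.H.toSubmodule * D.Np := by
  have hn' := hn
  rw [Np, aug] at hn'
  induction hn' using Submodule.iSup_induction' with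
  | zero => simp
  | add y z hy hz ihy ihz =>
    rw [add_mul]
    exact add_mem (ihy hy) (ihz hz)
  | mem θ n hnθ =>
    obtain ⟨⟨θ, hθ⟩, h0⟩ := θ
    have hwt : n * h ∈ D.adWt (D.rootWt θ) := by
      have := hD.wt_mul θ 1 n h hnθ.1 (rootWt_one_mem_comp hD hh)
      rwa [mul_one] at this
    have hHwt : ∀ θ' : P, D.H.toSubmodule * D.comp D.Bp (D.rootWt θ') ≤ D.adWt (D.rootWt θ') := by
      intro θ'
      refine Submodule.mul_le.2 fun x hx y hy => ?_
      have := hD.wt_mul 1 θ' x y (rootWt_one_mem_comp hD hx) hy.1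
      rwa [one_mul] at this
    have hmem : n * h ∈ D.H.toSubmodule * D.Bp.toSubmodule := by
      obtain ⟨S, hS⟩ := hD.H_Bp
      rw [← hS]
      refine S.mul_mem ?_ ?_
      · rw [← Subalgebra.mem_toSubmodule, hS]
        simpa using Submodule.mul_mem_mul (show (1 : A) ∈ D.H.toSubmodule from D.H.one_mem) hnθ.2
      · rw [← Subalgebra.mem_toSubmodule, hS]
        simpa using Submodule.mul_mem_mul hh (show (1 : A) ∈ D.Bp.toSubmodule from D.Bp.one_mem)
    rw [← hD.graded_Bp.sup, Submodule.mul_iSup] at hmem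
    have hle : ⨆ θ' : D.overCone D.posCone, D.H.toSubmodule * D.comp D.Bp (D.rootWt θ') ≤
        D.H.toSubmodule * D.comp D.Bp (D.rootWt θ) ⊔
          ⨆ θ' : {θ' : P // D.rootWt θ ≠ D.rootWt θ'}, weightSpace D.ad (D.rootWt θ') := by
      refine iSup_le fun θ' => ?_
      by_cases h : D.rootWt θ = D.rootWt θ'
      · rw [← h]
        exact le_sup_left
      · exact le_sup_of_le_right
          (le_iSup_of_le (f := fun θ' : {θ' : P // D.rootWt θ ≠ D.rootWt θ'} =>
            weightSpace D.ad (D.rootWt θ')) ⟨θ', h⟩ (hHwt θ'))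
    obtain ⟨u, hu, w, hw, huw⟩ := Submodule.mem_sup.1 (hle hmem)
    have hw' : w ∈ weightSpace D.ad (D.rootWt θ) := by
      rw [← adWt_eq_weightSpace, ← add_sub_cancel_left u w, huw]
      exact sub_mem hwt (hHwt θ hu)
    have hw0 := eq_zero_of_mem_weightSpace_of_mem_iSup (fun θ' => θ'.2) hw' hw
    rw [← huw, hw0, add_zero]
    exact mul_le_mul' le_rfl (comp_le_aug D.Bp hθ h0) hu

end Structure

/-! ### The projection `ξ` and the left ideal defining a Verma module. -/

section HarishChandraProjection

variable {k A P P₀ ι : Type*} [Field k] [Ring A] [Algebra k A] [Group P] [AddCommGroup P₀]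
variable {D : TriangularData k A P P₀ ι}

theorem εm_one (hD : D.IsRTA) : εm hD 1 = 1 := (exists_εm hD).choose_spec.1

theorem εm_eq_zero_iff (hD : D.IsRTA) (b : D.Bm) : εm hD b = 0 ↔ (b : A) ∈ D.Nm :=
  (exists_εm hD).choose_spec.2 b

theorem εp_one (hD : D.IsRTA) : εp hD 1 = 1 := (exists_εp hD).choose_spec.1

theorem εp_eq_zero_iff (hD : D.IsRTA) (b : D.Bp) : εp hD b = 0 ↔ (b : A) ∈ D.Np :=
  (exists_εp hD).choose_spec.2 b

theorem sub_εm_mem_Nm (hD : D.IsRTA) (b : D.Bm) : (b : A) - algebraMap k A (εm hD b) ∈ D.Nm := by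
  have := (εm_eq_zero_iff hD (b - algebraMap k D.Bm (εm hD b))).1 (by
    rw [map_sub, Algebra.algebraMap_eq_smul_one, map_smul, εm_one, smul_eq_mul, mul_one, sub_self])
  simpa using this

theorem sub_εp_mem_Np (hD : D.IsRTA) (b : D.Bp) : (b : A) - algebraMap k A (εp hD b) ∈ D.Np := by
  have := (εp_eq_zero_iff hD (b - algebraMap k D.Bp (εp hD b))).1 (by
    rw [map_sub, Algebra.algebraMap_eq_smul_one, map_smul, εp_one, smul_eq_mul, mul_one, sub_self])
  simpa using this

theorem ξ_mul (hD : D.IsRTA) (b : D.Bm) (h : D.H) (c : D.Bp) :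
    ξ hD (b * h * c) = (εp hD c * εm hD b) • h := by
  have : (LinearEquiv.ofBijective D.mulMap hD.triangular).symm ((b : A) * h * c) =
      (b ⊗ₜ[k] h) ⊗ₜ[k] c := by
    rw [LinearEquiv.symm_apply_eq]
    simp [mulMap]
  simp [ξ, this, mul_smul]

theorem ξ_one (hD : D.IsRTA) : ξ hD 1 = 1 := by
  simpa [εm_one, εp_one] using ξ_mul hD 1 1 1

theorem triangular_induction (hD : D.IsRTA) {p : A → Prop}
    (mul : ∀ (b : D.Bm) (h : D.H) (c : D.Bp), p (b * h * c))
    (add : ∀ x y, p x → p y → p (x + y)) (a : A) : p a := by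
  obtain ⟨t, rfl⟩ := hD.triangular.2 a
  induction t using TensorProduct.induction_on with
  | zero => simpa using mul 0 0 0
  | add x y hx hy =>
    rw [map_add]
    exact add _ _ hx hy
  | tmul x c =>
    induction x using TensorProduct.induction_on with
    | zero => simpa using mul 0 0 0
    | add x y hx hy =>
      rw [TensorProduct.add_tmul, map_add]
      exact add _ _ hx hy
    | tmul b h => simpa [mulMap] using mul b h c

theorem ξ_mul_Np (hD : D.IsRTA) (a : A) {n : A} (hn : n ∈ D.Np) : ξ hD (a * n) = 0 := by
  induction a using triangular_induction hD with
  | add x y hx hy => rw [add_mul, map_add, hx, hy, add_zero]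
  | mul b h c =>
    have hcn := mul_mem_Np hD c.2 hn
    have := ξ_mul hD b h ⟨(c : A) * n, aug_le _ _ hcn⟩
    rw [(εp_eq_zero_iff hD ⟨(c : A) * n, aug_le _ _ hcn⟩).2 hcn] at this
    simpa [mul_assoc] using this

theorem ξ_mul_sub (hD : D.IsRTA) (μ : D.G) (a : A) (h : D.H) :
    μ (ξ hD (a * ((h : A) - algebraMap k A (μ h)))) = 0 := by
  induction a using triangular_induction hD with
  | add x y hx hy => rw [add_mul, map_add, map_add, hx, hy, add_zero]
  | mul b h' c =>
    set n : A := (c : A) - algebraMap k A (εp hD c) with hn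
    have hn' : n ∈ D.Np := sub_εp_mem_Np hD c
    have hc : (c : A) = n + εp hD c • (1 : A) := by
      rw [hn, ← Algebra.algebraMap_eq_smul_one, sub_add_cancel]
    have hnh : ξ hD (b * h' * (n * h)) = 0 := by
      refine Submodule.mul_induction_on (mul_mem_H_mul_Np hD hn' h.2) ?_ ?_
      · intro x _ y hy
        rw [← mul_assoc]
        exact ξ_mul_Np hD _ hy
      · intro x y hx hy
        rw [mul_add, map_add, hx, hy, add_zero]
    -- With `c = n + ε⁺(c)`, the first two terms are killed by `ξ`, as they lie in `A N_+`. The last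
    -- has `H`-part a multiple of `h' (h - μ(h))`, which `μ` kills.
    have e : (b : A) * h' * c * ((h : A) - algebraMap k A (μ h)) =
        b * h' * (n * h) - μ h • (b * h' * n) +
          εp hD c • ((b : A) * (h' * (h - algebraMap k D.H (μ h)) : D.H) * (1 : D.Bp)) := by
      rw [hc, Algebra.algebraMap_eq_smul_one, Algebra.algebraMap_eq_smul_one]
      push_cast
      simp only [mul_add, add_mul, mul_sub, smul_sub, mul_smul_comm, smul_mul_assoc, mul_one,
        mul_assoc]
      module
    rw [e, map_add, map_sub, map_smul, map_smul, hnh, ξ_mul_Np hD _ hn', ξ_mul]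
    simp

/-- Consequently `μ ∘ ξ` descends to `Z_A(μ)`, where it reads off the coefficient of the highest
weight vector. -/
theorem ξ_vermaIdeal (hD : D.IsRTA) (μ : D.G) {x : A} (hx : x ∈ D.vermaIdeal μ) :
    μ (ξ hD x) = 0 := by
  suffices ∀ a : A, μ (ξ hD (a * x)) = 0 by simpa using this 1
  induction hx using Submodule.span_induction with
  | mem x hx =>
    intro a
    rcases hx with hx | ⟨h, rfl⟩
    · rw [ξ_mul_Np hD a hx, map_zero]
    · exact ξ_mul_sub hD μ a h
  | zero => simp
  | add x y _ _ hx hy =>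
    intro a
    rw [mul_add, map_add, map_add, hx, hy, add_zero]
  | smul b x _ hx =>
    intro a
    rw [smul_eq_mul, ← mul_assoc]
    exact hx _

theorem exists_sub_mem_vermaIdeal (hD : D.IsRTA) (μ : D.G) (a : A) :
    ∃ b : D.Bm, a - b ∈ D.vermaIdeal μ := by
  induction a using triangular_induction hD with
  | add x y hx hy =>
    obtain ⟨b, hb⟩ := hx
    obtain ⟨b', hb'⟩ := hy
    refine ⟨b + b', ?_⟩
    push_cast
    rw [add_sub_add_comm]
    exact add_mem hb hb'
  | mul b h c =>
    refine ⟨(εp hD c * μ h) • b, ?_⟩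
    have h1 : (b : A) * h * (c - algebraMap k A (εp hD c)) ∈ D.vermaIdeal μ :=
      Submodule.smul_mem _ ((b : A) * h)
        (Submodule.subset_span (Or.inl (sub_εp_mem_Np hD c)))
    have h2 : (εp hD c • (b : A)) * (h - algebraMap k A (μ h)) ∈ D.vermaIdeal μ :=
      Submodule.smul_mem _ (εp hD c • (b : A)) (Submodule.subset_span (Or.inr ⟨h, rfl⟩))
    convert add_mem h1 h2 using 1
    rw [Algebra.algebraMap_eq_smul_one, Algebra.algebraMap_eq_smul_one]
    push_cast
    simp only [mul_sub, mul_smul_comm, smul_mul_assoc, mul_one, mul_smul]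
    module

end HarishChandraProjection

/-! ### Weights of Verma modules, their simple quotients and subquotients. -/

section VermaWeights

variable {k A P P₀ ι : Type*} [Field k] [Ring A] [Algebra k A] [Group P] [AddCommGroup P₀]
variable {D : TriangularData k A P P₀ ι}

/-- The action of `H` on a Verma module. -/
noncomputable def vermaRep (D : TriangularData k A P P₀ ι) (μ : D.G) :
    D.H →ₐ[k] Module.End k (D.Verma μ) :=
  (Algebra.lsmul k k (D.Verma μ)).comp D.H.val

theorem vermaRep_apply (μ : D.G) (h : D.H) (x : D.Verma μ) : vermaRep D μ h x = (h : A) • x := rfl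

/-- The image of `a ∈ A` in the Verma module, i.e. `a` applied to the highest weight vector. -/
abbrev toVerma (D : TriangularData k A P P₀ ι) (μ : D.G) (a : A) : D.Verma μ :=
  Submodule.Quotient.mk a

theorem toVerma_one_mem_modWt (μ : D.G) : toVerma D μ 1 ∈ D.modWt (D.Verma μ) μ := by
  intro h
  rw [← Submodule.Quotient.mk_smul, ← Submodule.Quotient.mk_smul, Submodule.Quotient.eq,
    smul_eq_mul, smul_eq_mul, mul_one, mul_one]
  exact Submodule.subset_span (Or.inr ⟨h, rfl⟩)

theorem mem_weightSpace_of_mem_modWt {μ ν : D.G} {x : D.Verma μ}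
    (hx : x ∈ D.modWt (D.Verma μ) ν) : x ∈ weightSpace (vermaRep D μ) ν := by
  intro h
  rw [vermaRep_apply, hx h, algebraMap_smul]

theorem toVerma_mem_weightSpace (hD : D.IsRTA) (μ : D.G) {θ : P} {b : A}
    (hb : b ∈ D.adWt (D.rootWt θ)) :
    toVerma D μ b ∈ weightSpace (vermaRep D μ) (D.star θ μ) := by
  have := hD.wt_smul (D.Verma μ) θ μ b _ hb (toVerma_one_mem_modWt μ)
  rw [← Submodule.Quotient.mk_smul, smul_eq_mul, mul_one] at this
  exact mem_weightSpace_of_mem_modWt this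

/-- The sum of the weight spaces of a Verma module of restricted weights strictly below the highest
one. -/
noncomputable def lowerPart (D : TriangularData k A P P₀ ι) (μ : D.G) :
    Submodule k (D.Verma μ) :=
  ⨆ θ : {θ : D.overCone D.negCone // D.res (D.rootWt θ) ≠ D.rootWt₀ 0},
    weightSpace (vermaRep D μ) (D.star θ μ)

/-- Modulo the Verma ideal, `a` may be replaced by some `b ∈ B_-`; then `b - ε⁻(b)` lies in `N_-`,
which strictly lowers restricted weights. -/
theorem toVerma_sub_mem_lowerPart (hD : D.IsRTA) (μ : D.G) (a : A) :
    toVerma D μ a - μ (ξ hD a) • toVerma D μ 1 ∈ lowerPart D μ := by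
  obtain ⟨b, hb⟩ := exists_sub_mem_vermaIdeal hD μ a
  have h1 : toVerma D μ a = toVerma D μ b := (Submodule.Quotient.eq _).2 hb
  have h2 : μ (ξ hD a) = εm hD b := by
    have := ξ_vermaIdeal hD μ hb
    rw [map_sub, map_sub, sub_eq_zero] at this
    rw [this]
    have := ξ_mul hD b 1 1
    simp only [OneMemClass.coe_one, mul_one, εp_one, one_mul] at this
    rw [this, map_smul, map_one, smul_eq_mul, mul_one]
  have h3 : toVerma D μ a - μ (ξ hD a) • toVerma D μ 1 =
      toVerma D μ ((b : A) - algebraMap k A (εm hD b)) := by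
    rw [h1, h2, Algebra.algebraMap_eq_smul_one]
    rfl
  rw [h3]
  have hle : D.Nm ≤ (lowerPart D μ).comap (((D.vermaIdeal μ).mkQ).restrictScalars k) := by
    refine iSup_le fun θ => ?_
    intro x hx
    exact Submodule.mem_iSup_of_mem θ (toVerma_mem_weightSpace hD μ hx.1)
  exact hle (sub_εm_mem_Nm hD b)

/-- The weights of the Verma module `Z_A(μ)`. -/
theorem weight_cases (hD : D.IsRTA) {μ ν : D.G} {a : A}
    (ha : toVerma D μ a ∈ weightSpace (vermaRep D μ) ν) (h0 : toVerma D μ a ≠ 0) :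
    ν = μ ∨ ∃ θ : P, ∃ θ₀ ∈ D.negCone, D.res (D.rootWt θ) = D.rootWt₀ θ₀ ∧ θ₀ ≠ 0 ∧
      ν = D.star θ μ := by
  by_contra! hc
  obtain ⟨hνμ, hθ⟩ := hc
  let κ := {θ : D.overCone D.negCone // D.res (D.rootWt θ) ≠ D.rootWt₀ 0}
  let w : Option κ → D.G := fun o => o.elim μ fun θ => D.star θ μ
  refine h0 (eq_zero_of_mem_weightSpace_of_mem_iSup (w := w) ?_ ha ?_)
  · rintro (_ | ⟨⟨θ, θ₀, hθ₀, hres⟩, hne⟩)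
    · exact hνμ
    · refine hθ θ θ₀ hθ₀ hres ?_
      rintro rfl
      exact hne hres
  · rw [iSup_option, ← sub_add_cancel (toVerma D μ a) (μ (ξ hD a) • toVerma D μ 1)]
    exact add_mem (Submodule.mem_sup_right (toVerma_sub_mem_lowerPart hD μ a))
      (Submodule.mem_sup_left (Submodule.smul_mem _ _
        (mem_weightSpace_of_mem_modWt (toVerma_one_mem_modWt μ))))

theorem ne_star (hD : D.IsRTA) (μ : D.G)
    (θ : {θ : D.overCone D.negCone // D.res (D.rootWt θ) ≠ D.rootWt₀ 0}) :
    μ ≠ D.star θ μ := by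
  obtain ⟨⟨θ, θ₀, _, hθ⟩, h0⟩ := θ
  intro h
  have := hD.res_star θ θ₀ hθ μ
  rw [← h] at this
  rw [hD.star₀_free _ _ this.symm] at hθ
  exact h0 hθ

theorem toVerma_eq_smul (hD : D.IsRTA) {μ : D.G} {a : A}
    (ha : toVerma D μ a ∈ weightSpace (vermaRep D μ) μ) :
    toVerma D μ a = μ (ξ hD a) • toVerma D μ 1 :=
  sub_eq_zero.1 (eq_zero_of_mem_weightSpace_of_mem_iSup (ne_star hD μ)
    (sub_mem ha (Submodule.smul_mem _ _
      (mem_weightSpace_of_mem_modWt (toVerma_one_mem_modWt μ))))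
    (toVerma_sub_mem_lowerPart hD μ a))

/-- Otherwise some element of `H` kills the lower part of `a` and fixes its highest weight part, so
that `N` contains the generator of the Verma module. -/
theorem ξ_eq_zero_of_mem_of_ne_top (hD : D.IsRTA) {μ : D.G} {N : Submodule A (D.Verma μ)}
    (hN : N ≠ ⊤) {a : A} (ha : toVerma D μ a ∈ N) : μ (ξ hD a) = 0 := by
  by_contra h0
  refine hN ?_
  obtain ⟨r, hr, hr'⟩ := exists_annihilator (ne_star hD μ) (toVerma_sub_mem_lowerPart hD μ a)
  have h1 : (r : A) • toVerma D μ a = μ (ξ hD a) • toVerma D μ 1 := by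
    rw [map_sub, map_smul, sub_eq_zero, mem_weightSpace_of_mem_modWt (toVerma_one_mem_modWt μ) r,
      hr, one_smul] at hr'
    exact hr'
  have h2 : toVerma D μ 1 ∈ N := by
    have := N.smul_mem (algebraMap k A (μ (ξ hD a))⁻¹) (N.smul_mem (r : A) ha)
    rwa [h1, algebraMap_smul, smul_smul, inv_mul_cancel₀ h0, one_smul] at this
  rw [eq_top_iff]
  rintro x -
  obtain ⟨x, rfl⟩ := Submodule.Quotient.mk_surjective _ x
  have := N.smul_mem x h2
  rwa [← Submodule.Quotient.mk_smul, smul_eq_mul, mul_one] at this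

/-- The highest weight vector of the simple module `V_A(μ)`. -/
def simpleVec (D : TriangularData k A P P₀ ι) (μ : D.G) : D.Simple μ :=
  Submodule.Quotient.mk (toVerma D μ 1)

theorem simpleVec_ne_zero (hD : D.IsRTA) (μ : D.G) : simpleVec D μ ≠ 0 := by
  -- `K` is the radical of the form `(b, a) ↦ μ(ξ(b a))`. Its image contains every proper submodule,
  -- hence their sum, but not the class of `1`.
  let K : Submodule A A :=
    { carrier := {a | ∀ b, μ (ξ hD (b * a)) = 0}
      zero_mem' := fun b => by simp
      add_mem' := fun {x y} hx hy b => by rw [mul_add, map_add, map_add, hx, hy, add_zero]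
      smul_mem' := fun c x hx b => by rw [smul_eq_mul, ← mul_assoc]; exact hx _ }
  intro h
  have hmem : toVerma D μ 1 ∈ sSup {N : Submodule A (D.Verma μ) | N ≠ ⊤} :=
    (Submodule.Quotient.mk_eq_zero _).1 h
  have hle : sSup {N : Submodule A (D.Verma μ) | N ≠ ⊤} ≤ K.map (D.vermaIdeal μ).mkQ := by
    refine sSup_le fun N hN x hx => ?_
    obtain ⟨x, rfl⟩ := Submodule.Quotient.mk_surjective _ x
    refine ⟨x, fun b => ξ_eq_zero_of_mem_of_ne_top hD hN ?_, rfl⟩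
    exact N.smul_mem b hx
  obtain ⟨x, hx, hx1⟩ := hle hmem
  have h1 := ξ_vermaIdeal hD μ ((Submodule.Quotient.eq _).1 hx1)
  have h2 := hx 1
  rw [one_mul] at h2
  rw [map_sub, map_sub, ξ_one, map_one, h2, zero_sub, neg_eq_zero] at h1
  exact one_ne_zero h1

theorem smul_simpleVec {μ : D.G} {a : A} {c : k} (h : a - algebraMap k A c ∈ D.vermaIdeal μ) :
    a • simpleVec D μ = algebraMap k A c • simpleVec D μ := by
  have : toVerma D μ a = toVerma D μ (algebraMap k A c) := (Submodule.Quotient.eq _).2 h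
  rw [simpleVec, ← Submodule.Quotient.mk_smul, ← Submodule.Quotient.mk_smul,
    ← Submodule.Quotient.mk_smul, ← Submodule.Quotient.mk_smul, smul_eq_mul, smul_eq_mul, mul_one,
    mul_one]
  exact congrArg _ this

/-- If `V_A(ν)` is a subquotient of `Z_A(μ)`, then a left ideal containing the one that defines
`Z_A(μ)` compares with the annihilator of the highest weight vector of `V_A(ν)`. -/
theorem IsFactor.exists_leftIdeal {μ ν : D.G} (h : D.IsFactor ν μ) :
    ∃ (K : Submodule A A) (a : A), D.vermaIdeal μ ≤ K ∧
      ∀ r : A, r * a ∈ K ↔ r • simpleVec D ν = 0 := by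
  obtain ⟨N, N', ⟨e⟩⟩ := h
  obtain ⟨⟨n, hnN⟩, hn⟩ := Submodule.Quotient.mk_surjective _ (e.symm (simpleVec D ν))
  obtain ⟨a, rfl⟩ := Submodule.Quotient.mk_surjective _ n
  -- The subquotient is pulled back to `A`, because `Γ` acts on `A` and not on the Verma module.
  refine ⟨(N'.map N.subtype).comap (D.vermaIdeal μ).mkQ, a, ?_, fun r => ?_⟩
  · intro x hx
    rw [Submodule.mem_comap, Submodule.mkQ_apply, (Submodule.Quotient.mk_eq_zero _).2 hx]
    exact Submodule.zero_mem _
  · have h1 : r • e.symm (simpleVec D ν) = 0 ↔ r • simpleVec D ν = 0 := by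
      rw [← map_smul, LinearEquiv.map_eq_zero_iff]
    rw [← h1, ← hn, ← Submodule.Quotient.mk_smul, Submodule.Quotient.mk_eq_zero]
    constructor
    · rintro ⟨y, hy, hyr⟩
      have : y = r • ⟨Submodule.Quotient.mk a, hnN⟩ := Subtype.ext hyr
      rwa [← this]
    · intro hr
      exact ⟨_, hr, rfl⟩

/-- Once the subgroup contains the support, the truncated sum no longer depends on it; `χ_μ` can
then be summed over `Γ^μ` or over `Γ_μ` alike. -/
theorem coeff_partialChar {Γ : Type*} [Group Γ] [Finite Γ] (hD : D.IsRTA) (μ : D.G) (Γ' : Subgroup Γ) (r : SkewMonoidAlgebra A Γ)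
    (h : ∀ γ, μ (ξ hD (r.coeff γ)) ≠ 0 → γ ∈ Γ') (γ : Γ) :
    (partialChar hD μ Γ' r).coeff γ = μ (ξ hD (r.coeff γ)) := by
  classical
  cases nonempty_fintype Γ
  rw [partialChar, finsum_eq_sum_of_fintype, MonoidAlgebra.coeff_sum, Finset.sum_apply']
  simp only [MonoidAlgebra.coeff_single, Finsupp.single_apply]
  by_cases hγ : γ ∈ Γ'
  · rw [Finset.sum_eq_single ⟨γ, hγ⟩]
    · simp
    · intro b _ hb
      exact if_neg fun hb' => hb (Subtype.ext hb')
    · simp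
  · rw [Finset.sum_eq_zero]
    · by_contra hne
      exact hγ (h γ (Ne.symm hne))
    · intro b _
      exact if_neg fun hb : (b : Γ) = γ => hγ (hb ▸ b.2)

end VermaWeights

/-! ### Central elements on highest weight vectors; `χ_μ` as an algebra map. -/

section Center

variable {k A P P₀ ι : Type*} [Field k] [Ring A] [Algebra k A] [Group P] [AddCommGroup P₀]
variable {Γ : Type*} [Group Γ] [MulSemiringAction Γ A] [SMulCommClass Γ k A]
variable {D : TriangularData k A P P₀ ι}

theorem mul_coeff_eq_of_mem_center {z : SkewMonoidAlgebra A Γ}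
    (hz : z ∈ Subalgebra.center k (SkewMonoidAlgebra A Γ)) (γ : Γ) (a : A) :
    a * z.coeff γ = z.coeff γ * γ • a := by
  have := congrArg (fun r => r.coeff γ)
    (Subalgebra.mem_center_iff.1 hz (SkewMonoidAlgebra.single 1 a))
  simpa using this

theorem res_charAct (hΓ : D.IsCompatible Γ) (γ : Γ) (μ : D.G) :
    D.res (charAct hΓ.smul_H γ μ) = charAct hΓ.smul_H₀ γ (D.res μ) := rfl

variable [Finite Γ]

/-- An order-preserving action of a finite group has no strictly decreasing orbit. -/
theorem charAct_res_eq_of_le₀ (hD : D.IsRTA) (hΓ : D.IsCompatible Γ) {γ : Γ} {x : D.G₀}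
    (h : D.le₀ (charAct hΓ.smul_H₀ γ x) x) : charAct hΓ.smul_H₀ γ x = x := by
  have key : ∀ n : ℕ, D.le₀ (charAct hΓ.smul_H₀ (γ ^ (n + 1)) x) (charAct hΓ.smul_H₀ γ x) := by
    intro n
    induction n with
    | zero => rw [zero_add, pow_one]; exact le₀_refl _
    | succ n ih =>
      have h1 := hΓ.smul_le₀ γ _ _ ih
      rw [← charAct_mul, ← pow_succ'] at h1
      exact le₀_trans h1 (hΓ.smul_le₀ γ _ _ h)
  refine le₀_antisymm hD h ?_
  -- This choice of exponent gives `γ ^ orderOf γ = 1`, so the descending chain from `γ(x)` returns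
  -- to `x`.
  have := key (orderOf γ - 1)
  rwa [Nat.sub_add_cancel (orderOf_pos γ), pow_orderOf_eq_one, charAct_one] at this

/-- The coefficients of a central element act on the highest weight vector of a Verma module by
scalars, which vanish outside the stabilizer of the highest weight. -/
theorem toVerma_coeff (hD : D.IsRTA) (hΓ : D.IsCompatible Γ) (μ : D.G)
    {z : SkewMonoidAlgebra A Γ} (hz : z ∈ Subalgebra.center k (SkewMonoidAlgebra A Γ)) (γ : Γ) :
    z.coeff γ - algebraMap k A (μ (ξ hD (z.coeff γ))) ∈ D.vermaIdeal μ ∧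
      (μ (ξ hD (z.coeff γ)) ≠ 0 → γ ∈ stab hΓ μ) := by
  -- `h z_γ v = z_γ γ(h) v = μ(γ(h)) z_γ v`, whence the inverse of `γ`.
  have hwt : toVerma D μ (z.coeff γ) ∈ weightSpace (vermaRep D μ) (charAct hΓ.smul_H γ⁻¹ μ) := by
    intro h
    have h1 := toVerma_one_mem_modWt (D := D) μ ⟨γ • (h : A), hΓ.smul_H γ h h.2⟩
    have h2 : (h : A) • toVerma D μ (z.coeff γ) =
        z.coeff γ • ((γ • (h : A)) • toVerma D μ 1) := by
      rw [← Submodule.Quotient.mk_smul, ← Submodule.Quotient.mk_smul,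
        ← Submodule.Quotient.mk_smul, smul_eq_mul, smul_eq_mul, smul_eq_mul, mul_one,
        mul_coeff_eq_of_mem_center hz]
    rw [vermaRep_apply, h2, h1, charAct_apply, algebraMap_smul, smul_comm,
      ← Submodule.Quotient.mk_smul, smul_eq_mul, mul_one]
    simp only [inv_inv]
  by_cases h0 : toVerma D μ (z.coeff γ) = 0
  · have hI := (Submodule.Quotient.mk_eq_zero _).1 h0
    have hξ := ξ_vermaIdeal hD μ hI
    rw [hξ, map_zero, sub_zero]
    exact ⟨hI, fun h => absurd rfl h⟩
  · have hfix : charAct hΓ.smul_H γ⁻¹ μ = μ := by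
      rcases weight_cases hD hwt h0 with h | ⟨θ, θ₀, hθ₀, hres, hne, h⟩
      · exact h
      · exfalso
        have h1 : charAct hΓ.smul_H₀ γ⁻¹ (D.res μ) =
            D.star₀ (Multiplicative.ofAdd θ₀) (D.res μ) := by
          rw [← res_charAct hΓ, h, hD.res_star θ θ₀ hres]
        have h2 := charAct_res_eq_of_le₀ hD hΓ (γ := γ⁻¹) (x := D.res μ)
          ⟨-θ₀, hθ₀, by
            rw [h1, ← Equiv.Perm.mul_apply, ← map_mul, ← ofAdd_add]
            simp⟩
        rw [h1] at h2
        exact hne (hD.star₀_free _ _ h2)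
    refine ⟨?_, fun _ => ?_⟩
    · rw [hfix] at hwt
      rw [← Submodule.Quotient.eq]
      refine (toVerma_eq_smul hD hwt).trans ?_
      rw [Algebra.algebraMap_eq_smul_one]
      rfl
    · have : γ⁻¹ ∈ stab hΓ μ := hfix
      simpa using inv_mem this

/-- Although `μ ∘ ξ` is not multiplicative on `A`, a right factor `z_γ` acts on the highest weight
vector by a scalar, which comes out. -/
theorem ξ_mul_coeff (hD : D.IsRTA) (hΓ : D.IsCompatible Γ) (μ : D.G)
    {z : SkewMonoidAlgebra A Γ} (hz : z ∈ Subalgebra.center k (SkewMonoidAlgebra A Γ)) (γ : Γ)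
    (x : A) : μ (ξ hD (x * z.coeff γ)) = μ (ξ hD (z.coeff γ)) * μ (ξ hD x) := by
  have h := ξ_vermaIdeal hD μ
    ((D.vermaIdeal μ).smul_mem x (toVerma_coeff hD hΓ μ hz γ).1)
  rw [smul_eq_mul, mul_sub, map_sub, map_sub, sub_eq_zero, Algebra.algebraMap_eq_smul_one,
    mul_smul_comm, mul_one, map_smul, map_smul, smul_eq_mul] at h
  exact h

theorem coeff_centralChar (hD : D.IsRTA) (hΓ : D.IsCompatible Γ) (μ : D.G)
    {z : SkewMonoidAlgebra A Γ} (hz : z ∈ Subalgebra.center k (SkewMonoidAlgebra A Γ)) (γ : Γ) :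
    (centralChar hD hΓ μ z).coeff γ = μ (ξ hD (z.coeff γ)) :=
  coeff_partialChar hD μ _ z (fun γ => (toVerma_coeff hD hΓ μ hz γ).2) γ

theorem centralChar_mul (hD : D.IsRTA) (hΓ : D.IsCompatible Γ) (μ : D.G)
    {z z' : SkewMonoidAlgebra A Γ} (hz : z ∈ Subalgebra.center k (SkewMonoidAlgebra A Γ))
    (hz' : z' ∈ Subalgebra.center k (SkewMonoidAlgebra A Γ)) :
    centralChar hD hΓ μ (z * z') = centralChar hD hΓ μ z * centralChar hD hΓ μ z' := by
  classical
  cases nonempty_fintype Γ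
  refine MonoidAlgebra.ext (Finsupp.ext fun γ => ?_)
  have hs : ∀ {p : Γ × Γ},
      p ∈ (Finset.univ.filter fun p : Γ × Γ => p.1 * p.2 = γ) ↔ p.1 * p.2 = γ := by simp
  rw [coeff_centralChar hD hΓ μ (mul_mem hz hz'), MonoidAlgebra.coeff_mul_antidiag _ _ _ _ hs,
    SkewMonoidAlgebra.coeff_mul_antidiagonal_of_finset _ _ _ _ hs, map_sum, map_sum]
  refine Finset.sum_congr rfl fun p _ => ?_
  rw [coeff_centralChar hD hΓ μ hz, coeff_centralChar hD hΓ μ hz',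
    ← mul_coeff_eq_of_mem_center hz, ξ_mul_coeff hD hΓ μ hz]

theorem centralChar_algebraMap (hD : D.IsRTA) (hΓ : D.IsCompatible Γ) (μ : D.G) (c : k) :
    centralChar hD hΓ μ (algebraMap k (SkewMonoidAlgebra A Γ) c) =
      algebraMap k (MonoidAlgebra k Γ) c := by
  classical
  refine MonoidAlgebra.ext (Finsupp.ext fun γ => ?_)
  rw [coeff_centralChar hD hΓ μ (Subalgebra.algebraMap_mem _ c), Algebra.algebraMap_eq_smul_one,
    Algebra.algebraMap_eq_smul_one, SkewMonoidAlgebra.coeff_smul, SkewMonoidAlgebra.coeff_one,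
    MonoidAlgebra.coeff_smul, MonoidAlgebra.one_def, MonoidAlgebra.coeff_single,
    Finsupp.smul_apply, Finsupp.smul_apply, map_smul, map_smul, Finsupp.single_apply,
    Finsupp.single_apply]
  split_ifs <;> simp [ξ_one]

theorem centralChar_add (hD : D.IsRTA) (hΓ : D.IsCompatible Γ) (μ : D.G)
    {z z' : SkewMonoidAlgebra A Γ} (hz : z ∈ Subalgebra.center k (SkewMonoidAlgebra A Γ))
    (hz' : z' ∈ Subalgebra.center k (SkewMonoidAlgebra A Γ)) :
    centralChar hD hΓ μ (z + z') = centralChar hD hΓ μ z + centralChar hD hΓ μ z' := by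
  refine MonoidAlgebra.ext (Finsupp.ext fun γ => ?_)
  rw [MonoidAlgebra.coeff_add, Finsupp.add_apply, coeff_centralChar hD hΓ μ (add_mem hz hz'),
    coeff_centralChar hD hΓ μ hz, coeff_centralChar hD hΓ μ hz', SkewMonoidAlgebra.coeff_add,
    Finsupp.add_apply, map_add, map_add]

/-- The restriction of the central character to the center, as an algebra map. -/
noncomputable def centralCharHom (hD : D.IsRTA) (hΓ : D.IsCompatible Γ) (μ : D.G) :
    Subalgebra.center k (SkewMonoidAlgebra A Γ) →ₐ[k] MonoidAlgebra k Γ where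
  toFun z := centralChar hD hΓ μ z
  map_one' := (congrArg _ (map_one _).symm).trans
    ((centralChar_algebraMap hD hΓ μ 1).trans (map_one _))
  map_mul' z z' := centralChar_mul hD hΓ μ z.2 z'.2
  map_zero' := (congrArg _ (map_zero _).symm).trans
    ((centralChar_algebraMap hD hΓ μ 0).trans (map_zero _))
  map_add' z z' := centralChar_add hD hΓ μ z.2 z'.2
  commutes' c := centralChar_algebraMap hD hΓ μ c

end Center

/-! ### Comparing central characters along `S³_A(μ)`. -/

section Linkage

variable {k A P P₀ ι : Type*} [Field k] [Ring A] [Algebra k A] [Group P] [AddCommGroup P₀]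
variable {Γ : Type*} [Group Γ] [MulSemiringAction Γ A] [SMulCommClass Γ k A]
variable {D : TriangularData k A P P₀ ι}

variable (Γ) in
/-- The elements of `Γ` in the support of some value of the central character `χ_μ`. -/
def charSupport (hD : D.IsRTA) (μ : D.G) : Set Γ :=
  {γ | ∃ z ∈ Subalgebra.center k (SkewMonoidAlgebra A Γ), μ (ξ hD (z.coeff γ)) ≠ 0}

variable (Γ) in
/-- The subgroup `Γ_μ` generated by the supports of the values of the central character `χ_μ`. -/
def charGroup (hD : D.IsRTA) (μ : D.G) : Subgroup Γ := Subgroup.closure (charSupport Γ hD μ)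

variable (Γ) in
/-- The central characters of weights `μ` and `ν` are proportional, up to a character of the
common subgroup `Γ_μ = Γ_ν`. -/
def IsProportional (hD : D.IsRTA) (μ ν : D.G) : Prop :=
  charSupport Γ hD μ = charSupport Γ hD ν ∧
    ∃ c : Γ → kˣ, (∀ γ ∈ charGroup Γ hD μ, ∀ γ' ∈ charGroup Γ hD μ, c (γ * γ') = c γ * c γ') ∧
      ∀ γ ∈ charSupport Γ hD μ, ∀ z ∈ Subalgebra.center k (SkewMonoidAlgebra A Γ),
        μ (ξ hD (z.coeff γ)) = (c γ : k) * ν (ξ hD (z.coeff γ))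

theorem IsProportional.refl (hD : D.IsRTA) (μ : D.G) : IsProportional Γ hD μ μ :=
  ⟨rfl, 1, by simp, by simp⟩

theorem IsProportional.symm {hD : D.IsRTA} {μ ν : D.G} (h : IsProportional Γ hD μ ν) :
    IsProportional Γ hD ν μ := by
  obtain ⟨hs, c, hc, h⟩ := h
  refine ⟨hs.symm, c⁻¹, ?_, ?_⟩
  · rw [charGroup, ← hs]
    intro γ hγ γ' hγ'
    rw [Pi.inv_apply, Pi.inv_apply, Pi.inv_apply, hc γ hγ γ' hγ', mul_inv]
  · rw [← hs]
    intro γ hγ z hz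
    rw [h γ hγ z hz, Pi.inv_apply, Units.inv_mul_cancel_left]

theorem IsProportional.trans {hD : D.IsRTA} {μ ν κ : D.G} (h : IsProportional Γ hD μ ν)
    (h' : IsProportional Γ hD ν κ) : IsProportional Γ hD μ κ := by
  obtain ⟨hs, c, hc, h⟩ := h
  obtain ⟨hs', c', hc', h'⟩ := h'
  refine ⟨hs.trans hs', c * c', ?_, ?_⟩
  · intro γ hγ γ' hγ'
    rw [charGroup, ← hs] at hc'
    rw [Pi.mul_apply, Pi.mul_apply, Pi.mul_apply, hc γ hγ γ' hγ', hc' γ hγ γ' hγ',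
      mul_mul_mul_comm]
  · intro γ hγ z hz
    rw [h γ hγ z hz, h' γ (hs ▸ hγ) z hz, Pi.mul_apply, Units.val_mul, mul_assoc]

variable [Finite Γ]

theorem charGroup_le_stab (hD : D.IsRTA) (hΓ : D.IsCompatible Γ) (μ : D.G) :
    charGroup Γ hD μ ≤ stab hΓ μ := by
  refine (Subgroup.closure_le _).2 ?_
  rintro γ ⟨z, hz, h⟩
  exact (toVerma_coeff hD hΓ μ hz γ).2 h

/-- Each `γ ∈ Γ_μ` satisfies `γ⁻¹(K) ⊆ K` and `γ⁻¹(a) ≡ c(γ) a` mod `K` for a unique nonzero scalar;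
uniqueness makes `c` multiplicative, and its inverse is the required ratio. -/
theorem isProportional_of_isFactor (hD : D.IsRTA) (hΓ : D.IsCompatible Γ) {μ ν : D.G}
    (h : D.IsFactor ν μ) : IsProportional Γ hD μ ν := by
  obtain ⟨K, a, hK, ha⟩ := h.exists_leftIdeal
  have haK : a ∉ K := fun h => simpleVec_ne_zero hD ν (by simpa using (ha 1).1 (by rwa [one_mul]))
  have hcancel : ∀ {c : k} {x : A}, c ≠ 0 → c • x ∈ K → x ∈ K := fun {c x} hc hx => by
    simpa [smul_smul, inv_mul_cancel₀ hc] using K.smul_of_tower_mem c⁻¹ hx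
  have hscal : ∀ {c : k}, c • a ∈ K → c = 0 := fun {c} hc => by
    by_contra h0
    exact haK (hcancel h0 hc)
  -- `z_γ x = γ⁻¹(x) z_γ`, and `z_γ` is congruent to its scalar modulo the Verma ideal of `μ`.
  have hdiff : ∀ z ∈ Subalgebra.center k (SkewMonoidAlgebra A Γ), ∀ (γ : Γ) (x : A),
      z.coeff γ * x - μ (ξ hD (z.coeff γ)) • γ⁻¹ • x ∈ K := by
    intro z hz γ x
    have h1 := (D.vermaIdeal μ).smul_mem (γ⁻¹ • x) (toVerma_coeff hD hΓ μ hz γ).1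
    have h2 := mul_coeff_eq_of_mem_center hz γ (γ⁻¹ • x)
    rw [smul_inv_smul] at h2
    rw [smul_eq_mul, mul_sub, h2, ← Algebra.commutes, ← Algebra.smul_def] at h1
    exact hK h1
  have hvec : ∀ z ∈ Subalgebra.center k (SkewMonoidAlgebra A Γ), ∀ γ : Γ,
      μ (ξ hD (z.coeff γ)) • γ⁻¹ • a - ν (ξ hD (z.coeff γ)) • a ∈ K := by
    intro z hz γ
    have h1 : (z.coeff γ - algebraMap k A (ν (ξ hD (z.coeff γ)))) * a ∈ K := by
      rw [ha, sub_smul, sub_eq_zero]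
      exact smul_simpleVec (toVerma_coeff hD hΓ ν hz γ).1
    rw [sub_mul, ← Algebra.smul_def] at h1
    simpa using sub_mem h1 (hdiff z hz γ a)
  have hstable : ∀ γ ∈ charSupport Γ hD μ, ∀ x ∈ K, γ⁻¹ • x ∈ K := by
    rintro γ ⟨z, hz, hne⟩ x hx
    have h1 := sub_mem (K.smul_mem (z.coeff γ) hx) (hdiff z hz γ x)
    rw [smul_eq_mul, sub_sub_cancel] at h1
    exact hcancel hne h1
  -- If `γ⁻¹(a)` were in `K`, stability would put every positive power of `γ⁻¹` applied to `a` in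
  -- `K`, and one such power is the identity.
  have hne : ∀ γ ∈ charSupport Γ hD μ, γ⁻¹ • a ∉ K := by
    intro γ hγ h0
    have hpow : ∀ n : ℕ, (γ⁻¹) ^ (n + 1) • a ∈ K := by
      intro n
      induction n with
      | zero => simpa using h0
      | succ n ih =>
        rw [pow_succ', mul_smul]
        exact hstable γ hγ _ ih
    have := hpow (orderOf γ⁻¹ - 1)
    rw [Nat.sub_add_cancel (orderOf_pos _), pow_orderOf_eq_one, one_smul] at this
    exact haK this
  have hiff : ∀ z ∈ Subalgebra.center k (SkewMonoidAlgebra A Γ), ∀ γ : Γ,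
      μ (ξ hD (z.coeff γ)) = 0 ↔ ν (ξ hD (z.coeff γ)) = 0 := by
    intro z hz γ
    have h1 := hvec z hz γ
    constructor
    · intro h0
      rw [h0, zero_smul, zero_sub, neg_mem_iff] at h1
      exact hscal h1
    · intro h0
      rw [h0, zero_smul, sub_zero] at h1
      by_contra h2
      exact hne γ ⟨z, hz, h2⟩ (hcancel h2 h1)
  have hex : ∀ γ ∈ charGroup Γ hD μ, ∃ c : kˣ,
      (∀ x ∈ K, γ⁻¹ • x ∈ K) ∧ γ⁻¹ • a - (c : k) • a ∈ K := by
    intro γ hγ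
    -- In a finite group the generated submonoid is already the subgroup, so the induction needs no
    -- case for inverses.
    rw [charGroup, ← Subgroup.mem_toSubmonoid, Subgroup.closure_toSubmonoid_of_finite] at hγ
    induction hγ using Submonoid.closure_induction with
    | mem γ hγ =>
      obtain ⟨z, hz, h0⟩ := hγ
      have h1 : ν (ξ hD (z.coeff γ)) ≠ 0 := fun h => h0 ((hiff z hz γ).2 h)
      refine ⟨Units.mk0 _ (mul_ne_zero (inv_ne_zero h0) h1), hstable γ ⟨z, hz, h0⟩,
        hcancel h0 ?_⟩
      rw [Units.val_mk0, smul_sub, smul_smul, mul_inv_cancel_left₀ h0]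
      exact hvec z hz γ
    | one => exact ⟨1, by simp, by simp⟩
    | mul γ γ' _ _ h h' =>
      obtain ⟨c, hc, hc'⟩ := h
      obtain ⟨d, hd, hd'⟩ := h'
      refine ⟨c * d, fun x hx => ?_, ?_⟩
      · rw [mul_inv_rev, mul_smul]
        exact hd _ (hc _ hx)
      · have h1 := add_mem (hd _ hc') (K.smul_of_tower_mem (c : k) hd')
        rw [smul_sub, smul_sub, smul_comm γ'⁻¹ (c : k) a, sub_add_sub_cancel] at h1
        rwa [mul_inv_rev, mul_smul, Units.val_mul, mul_smul]
  have huniq : ∀ {γ : Γ} {c d : kˣ}, γ⁻¹ • a - (c : k) • a ∈ K → γ⁻¹ • a - (d : k) • a ∈ K →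
      c = d := by
    intro γ c d hc hd
    have := sub_mem hd hc
    rw [sub_sub_sub_cancel_left, ← sub_smul] at this
    exact Units.ext (sub_eq_zero.1 (hscal this))
  -- Off `charGroup` the value of `c` is arbitrary. A function on all of `Γ` avoids transport
  -- between `Γ_μ` and `Γ_ν`.
  choose! c hcK hc using hex
  refine ⟨?_, fun γ => (c γ)⁻¹, ?_, ?_⟩
  · ext γ
    exact exists_congr fun z => and_congr_right fun hz => not_congr (hiff z hz γ)
  · intro γ hγ γ' hγ'
    rw [← mul_inv]
    refine congrArg _ (huniq (hc _ (mul_mem hγ hγ')) ?_)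
    have h1 := add_mem (hcK _ hγ' _ (hc _ hγ)) (K.smul_of_tower_mem (c γ : k) (hc _ hγ'))
    rw [smul_sub, smul_sub, smul_comm γ'⁻¹ (c γ : k) a, sub_add_sub_cancel] at h1
    rwa [mul_inv_rev, mul_smul, Units.val_mul, mul_smul]
  · intro γ hγ z hz
    have h1 := K.smul_of_tower_mem (μ (ξ hD (z.coeff γ))) (hc γ (Subgroup.subset_closure hγ))
    have h2 := sub_mem (hvec z hz γ) h1
    rw [smul_sub, sub_sub_sub_cancel_left, smul_smul, ← sub_smul] at h2
    rw [← sub_eq_zero.1 (hscal h2), mul_comm, Units.mul_inv_cancel_right]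

theorem isProportional_of_mem_S3 (hD : D.IsRTA) (hΓ : D.IsCompatible Γ) {μ ν : D.G}
    (h : ν ∈ D.S3 μ) : IsProportional Γ hD μ ν := by
  change Relation.EqvGen D.IsFactor μ ν at h
  induction h with
  | rel _ _ h => exact (isProportional_of_isFactor hD hΓ h).symm
  | refl => exact .refl hD _
  | symm _ _ _ ih => exact ih.symm
  | trans _ _ _ _ _ ih ih' => exact ih.trans ih'

end Linkage
end TriangularData

/-! ### The theorem, with `Γ_μ` generated by the support of `χ_μ`. -/

theorem theorem9 {k A P P₀ ι Γ : Type*} [Field k] [Ring A] [Algebra k A] [Group P]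
    [AddCommGroup P₀] [Finite ι] [Group Γ] [Finite Γ] [MulSemiringAction Γ A] [SMulCommClass Γ k A]
    (hk : Nontrivial Γ → CharZero k)
    (D : TriangularData k A P P₀ ι) (hD : D.IsRTA) (hΓ : D.IsCompatible Γ) :
    (∀ μ : D.G, ∃ φ : Subalgebra.center k (SkewMonoidAlgebra A Γ) →ₐ[k] MonoidAlgebra k Γ,
      ∀ z, φ z = TriangularData.centralChar hD hΓ μ (z : SkewMonoidAlgebra A Γ)) ∧
    ∃ Γ_ : D.G → Subgroup Γ, ∀ μ : D.G,
      Γ_ μ ≤ TriangularData.stabS3 hΓ μ ∧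
      (∀ z ∈ Subalgebra.center k (SkewMonoidAlgebra A Γ),
        TriangularData.centralChar hD hΓ μ z = TriangularData.partialChar hD μ (Γ_ μ) z) ∧
      ∀ ν ∈ D.S3 μ,
        Γ_ μ = Γ_ ν ∧
        ∃ θ : Γ_ μ →* kˣ, ∀ γ : Γ_ μ, ∀ z ∈ Subalgebra.center k (SkewMonoidAlgebra A Γ),
          μ (TriangularData.ξ hD (z.coeff γ)) =
            (θ γ : k) * ν (TriangularData.ξ hD (z.coeff γ)) := by
  open TriangularData in
  refine ⟨fun μ => ⟨centralCharHom hD hΓ μ, fun z => rfl⟩, fun μ => charGroup Γ hD μ, fun μ => ?_⟩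
  have hsupp : ∀ z ∈ Subalgebra.center k (SkewMonoidAlgebra A Γ), ∀ γ,
      μ (ξ hD (z.coeff γ)) ≠ 0 → γ ∈ charGroup Γ hD μ := fun z hz γ h =>
    Subgroup.subset_closure ⟨z, hz, h⟩
  have hgroup : ∀ ν ∈ D.S3 μ, charGroup Γ hD μ = charGroup Γ hD ν := fun ν hν =>
    congrArg Subgroup.closure (isProportional_of_mem_S3 hD hΓ hν).1
  refine ⟨?_, fun z hz => ?_, fun ν hν => ⟨hgroup ν hν, ?_⟩⟩
  · refine le_iInf₂ fun ν hν => ?_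
    refine (hgroup ν hν).le.trans ?_
    exact charGroup_le_stab hD hΓ ν
  · refine MonoidAlgebra.ext (Finsupp.ext fun γ => ?_)
    rw [coeff_centralChar hD hΓ μ hz, coeff_partialChar hD μ _ z (hsupp z hz)]
  · obtain ⟨hs, c, hc, h⟩ := isProportional_of_mem_S3 hD hΓ hν
    refine ⟨MonoidHom.mk' (fun γ => c γ) fun γ γ' => hc γ γ.2 γ' γ'.2, fun γ z hz => ?_⟩
    -- `Γ_μ` may be larger than the support that generates it; off the support, which `μ` and `ν`
    -- share, both sides vanish.
    by_cases hγ : (γ : Γ) ∈ charSupport Γ hD μ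
    · exact h γ hγ z hz
    · have hμ : μ (ξ hD (z.coeff γ)) = 0 := by
        by_contra h0
        exact hγ ⟨z, hz, h0⟩
      have hν' : ν (ξ hD (z.coeff γ)) = 0 := by
        by_contra h0
        exact hγ (hs ▸ ⟨z, hz, h0⟩)
      rw [hμ, hν', mul_zero]
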